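/- **Theorem 3.1.** Let $\mathbb F_q$ be a finite field with $q$ elements, and let $\mu_q^\infty$ be the product measure on the space $\mathbb F_q^\infty$ of sequences $\mathcal S=(s_n)_{n\ge 0}$ over $\mathbb F_q$ each of whose factors is the uniform probability measure $\mu_q$ on $\mathbb F_q$ (with $\mu_q(\{a\})=1/q$ for every $a\in\mathbb F_q$). For $\mathcal S\in\mathbb F_q^\infty$ put $G(x)=\sum_{n\ge 0}s_nx^n\in\mathbb F_q[[x]]$. For a positive integer $N$, let the $N$th expansion complexity $E_N(\mathcal S)$ be $0$ if $s_0=\dots=s_{N-1}=0$, and otherwise the least total degree of a nonzero polynomial $h(x,y)\in\mathbb F_q[x,y]$ with $h(x,G(x))\equiv 0 \pmod{x^N}$. Then, for $\mu_q^\infty$-almost every sequence $\mathcal S\in\mathbb F_q^\infty$, $$\liminf_{N\to\infty}\frac{E_N(\mathcal S)}{\sqrt N}\ \ge\ \frac{\sqrt2}{2}.$$ -/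

import Mathlib

open MeasureTheory Filter

noncomputable section

/-- The generating function `G(x) = ∑ sₙ xⁿ` of a sequence over `F`. -/
def genFun {F : Type*} (S : ℕ → F) : PowerSeries F :=
  PowerSeries.mk S

/-- `h(x, G(x)) ≡ 0 mod x ^ N`, where the variables `0` and `1` of `h` stand for `x` and `y` and
`G` is the generating function of `S`. -/
def VanishesModXPow {F : Type*} [Field F] (S : ℕ → F) (N : ℕ) (h : MvPolynomial (Fin 2) F) :
    Prop :=
  (PowerSeries.X : PowerSeries F) ^ N ∣
    MvPolynomial.aeval ![(PowerSeries.X : PowerSeries F), genFun S] h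

open scoped Classical in
/-- The `N`th expansion complexity `E_N(S)`: zero if the first `N` terms of `S` vanish, and
otherwise the least total degree of a nonzero polynomial `h(x, y)` with
`h(x, G(x)) ≡ 0 mod x ^ N` (such polynomials always exist, for instance `x ^ N`). -/
def expansionComplexity {F : Type*} [Field F] (S : ℕ → F) (N : ℕ) : ℕ :=
  if ∀ n < N, S n = 0 then 0
  else sInf {d : ℕ | ∃ h : MvPolynomial (Fin 2) F,
    h ≠ 0 ∧ VanishesModXPow S N h ∧ h.totalDegree = d}

/-- The product measure on the sequence space over a finite set `F` each of whose factors is the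
uniform probability measure on `F`. -/
def uniformSeqMeasure (F : Type*) [Fintype F] [Nonempty F] [MeasurableSpace F] :
    Measure (ℕ → F) :=
  Measure.infinitePi fun _ : ℕ => (PMF.uniformOfFintype F).toMeasure

end

/-! Put `s = ⌊√(N/2)⌋`. If some nonzero `h` of degree below `s` vanishes at `(x, G)` to order `N ≥
2s²`, then, orders and degrees both being additive over factors, an irreducible factor `g` of degree
`e < s` vanishes to order `2es`. Such a `g` confines `G` to few cylinders. A Bézout bound shows that
`∂g/∂y` vanishes at `(x, G)` to order at most `e(e-1)`, so by Hensel `G` agrees with one of at most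
`e` power series roots of `g` up to order `K = 2es - e(e-1)`. This has probability at most `e
q^(-K)`. There are at most `q^T` candidates `g`, where `T = (e+1)(e+2)/2`, and `K - T ≥ s/2`.
Summing over `e < s` bounds the exceptional probability by `s² 2^(-s/2)`, which is summable, and
Borel–Cantelli concludes. -/

/-! ### A Bézout bound by counting dimensions -/

theorem finrank_restrictTotalDegree_fin_two (F : Type*) [Field F] (D : ℕ) :
    2 * Module.finrank F (MvPolynomial.restrictTotalDegree (Fin 2) F D) = (D + 1) * (D + 2) := by
  have hcard : Nat.card {n : Fin 2 →₀ ℕ | (n.sum fun _ e => e) ≤ D} =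
      ∑ k ∈ Finset.range (D + 1), (k + 1) := by
    have e : {n : Fin 2 →₀ ℕ | (n.sum fun _ e => e) ≤ D} ≃
        (Finset.range (D + 1)).sigma fun k => Finset.HasAntidiagonal.antidiagonal k :=
      { toFun := fun n => ⟨⟨n.1 0 + n.1 1, (n.1 0, n.1 1)⟩, by
          have := n.2
          simp [Finsupp.sum_fintype] at this
          simp; omega⟩
        invFun := fun x => ⟨Finsupp.equivFunOnFinite.symm ![x.1.2.1, x.1.2.2], by
          obtain ⟨⟨k, a, b⟩, hx⟩ := x
          simp [Finsupp.sum_fintype] at hx ⊢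
          omega⟩
        left_inv := fun n => by
          ext i
          fin_cases i <;> simp
        right_inv := fun x => by
          obtain ⟨⟨k, a, b⟩, hx⟩ := x
          simp at hx
          obtain ⟨_, rfl⟩ := hx
          simp }
    rw [Nat.card_congr e, Nat.card_eq_fintype_card, Fintype.card_coe, Finset.card_sigma]
    simp
  rw [MvPolynomial.restrictTotalDegree,
    Module.finrank_eq_nat_card_basis (MvPolynomial.basisRestrictSupport F _), hcard]
  induction D with
  | zero => simp
  | succ D ih =>
    have ih' : 2 * ∑ k ∈ Finset.range (D + 1), (k + 1) = (D + 1) * (D + 2) := by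
      clear ih hcard
      induction D with
      | zero => simp
      | succ D ih => rw [Finset.sum_range_succ, mul_add, ih]; ring
    rw [Finset.sum_range_succ, mul_add, ih']; ring

-- Bézout on the curve `y = G(x)`. In degree at most `e + d + m`, vanishing mod `x ^ m` has
-- codimension exactly `m`, since polynomials in `x` alone attain every residue. The multiples of
-- `f` and of `g` lie in that kernel and, by coprimality, meet only in multiples of `f * g`;
-- comparing dimensions leaves `m ≤ d * e`.
open MvPolynomial in
theorem le_totalDegree_mul_of_X_pow_dvd_aeval {F : Type*} [Field F] {f g : MvPolynomial (Fin 2) F}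
    (hf : f ≠ 0) (hg : g ≠ 0) (hfg : ∀ a, g ∣ f * a → g ∣ a) (G : PowerSeries F) {m : ℕ}
    (hfm : (PowerSeries.X : PowerSeries F) ^ m ∣ aeval ![PowerSeries.X, G] f)
    (hgm : (PowerSeries.X : PowerSeries F) ^ m ∣ aeval ![PowerSeries.X, G] g) :
    m ≤ f.totalDegree * g.totalDegree := by
  classical
  set d := f.totalDegree with hd
  set e := g.totalDegree with he
  set V := restrictTotalDegree (Fin 2) F
  have hV : ∀ k, 2 * Module.finrank F (V k) = (k + 1) * (k + 2) :=
    finrank_restrictTotalDegree_fin_two F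
  have memV : ∀ k p, p ∈ V k ↔ p.totalDegree ≤ k := fun k p => mem_restrictTotalDegree _ _ _
  let ψ₀ : MvPolynomial (Fin 2) F →ₗ[F] (Fin m → F) :=
    LinearMap.pi fun i => (PowerSeries.coeff (i : ℕ)) ∘ₗ (aeval ![PowerSeries.X, G]).toLinearMap
  have hψ₀ : ∀ p i, ψ₀ p i = PowerSeries.coeff (i : ℕ) (aeval ![PowerSeries.X, G] p) :=
    fun p i => rfl
  have hψ_dvd : ∀ p, (PowerSeries.X : PowerSeries F) ^ m ∣ aeval ![PowerSeries.X, G] p →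
      ψ₀ p = 0 := fun p hp => by
    ext i
    rw [hψ₀, PowerSeries.X_pow_dvd_iff.1 hp i i.2, Pi.zero_apply]
  let ψ : V (e + d + m) →ₗ[F] (Fin m → F) := ψ₀ ∘ₗ (V (e + d + m)).subtype
  have hsurj : LinearMap.range ψ = ⊤ := by
    rw [LinearMap.range_eq_top]
    intro v
    have hmem : ∑ i : Fin m, C (v i) * (X 0 : MvPolynomial (Fin 2) F) ^ (i : ℕ) ∈
        V (e + d + m) := by
      refine Submodule.sum_mem _ fun i _ => ?_
      rw [memV]
      refine (totalDegree_mul _ _).trans ?_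
      rw [totalDegree_C, totalDegree_X_pow]
      omega
    refine ⟨⟨_, hmem⟩, ?_⟩
    ext j
    change ψ₀ _ j = _
    rw [hψ₀]
    simp only [Submodule.subtype_apply, map_sum, map_mul, map_pow, aeval_X, algHom_C, Matrix.cons_val_zero]
    rw [Finset.sum_eq_single j]
    · simp [PowerSeries.coeff_X_pow]
    · intro b _ hb
      have : (j : ℕ) ≠ b := fun h => hb (Fin.ext h.symm)
      simp [PowerSeries.coeff_X_pow, this]
    · simp
  have hrank := LinearMap.finrank_range_add_finrank_ker ψ
  rw [hsurj, finrank_top, Module.finrank_fin_fun] at hrank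
  have hmap : ∀ (p : MvPolynomial (Fin 2) F) (k : ℕ), p ≠ 0 →
      Module.finrank F ((V k).map (LinearMap.mulLeft F p)) = Module.finrank F (V k) :=
    fun p k hp => (LinearEquiv.finrank_eq (Submodule.equivMapOfInjective _
      (fun a b hab => mul_left_cancel₀ hp hab) _)).symm
  set U := (V (d + m)).map (LinearMap.mulLeft F g)
  set W := (V (e + m)).map (LinearMap.mulLeft F f)
  have hinf : U ⊓ W ≤ (V m).map (LinearMap.mulLeft F (f * g)) := by
    rintro P ⟨⟨a, ha, rfl⟩, ⟨b, hb, hab⟩⟩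
    simp only [LinearMap.mulLeft_apply] at hab ⊢
    obtain ⟨c, rfl⟩ := hfg b ⟨a, hab⟩
    refine ⟨c, ?_, by simp only [LinearMap.mulLeft_apply]; rw [← hab]; ring⟩
    change _ ∈ V m
    by_cases hc : c = 0
    · rw [hc]; exact Submodule.zero_mem _
    have hb' : g * c ∈ V (e + m) := hb
    rw [memV, totalDegree_mul_of_isDomain hg hc] at hb'
    rw [memV]
    omega
  have hsup : U ⊔ W ≤ (LinearMap.ker ψ).map (V (e + d + m)).subtype := by
    refine sup_le ?_ ?_
    · rintro _ ⟨a, ha, rfl⟩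
      have ha' : a ∈ V (d + m) := ha
      rw [memV] at ha'
      have hmem : g * a ∈ V (e + d + m) := by
        rw [memV]
        have := totalDegree_mul g a
        omega
      refine ⟨⟨_, hmem⟩, hψ_dvd _ ?_, rfl⟩
      simp only [Submodule.coe_subtype, map_mul]
      exact Dvd.dvd.mul_right hgm _
    · rintro _ ⟨a, ha, rfl⟩
      have ha' : a ∈ V (e + m) := ha
      rw [memV] at ha'
      have hmem : f * a ∈ V (e + d + m) := by
        rw [memV]
        have := totalDegree_mul f a
        omega
      refine ⟨⟨_, hmem⟩, hψ_dvd _ ?_, rfl⟩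
      simp only [Submodule.coe_subtype, map_mul]
      exact Dvd.dvd.mul_right hfm _
  have h1 := Submodule.finrank_sup_add_finrank_inf_eq U W
  have h2 := Submodule.finrank_mono hinf
  have h3 := Submodule.finrank_mono hsup
  rw [hmap _ _ (mul_ne_zero hf hg)] at h2
  rw [hmap _ _ hg, hmap _ _ hf] at h1
  rw [Submodule.finrank_map_subtype_eq] at h3
  have a1 := hV m
  have a2 := hV (d + m)
  have a3 := hV (e + m)
  have a4 := hV (e + d + m)
  have key : (d + m + 1) * (d + m + 2) + (e + m + 1) * (e + m + 2) + 2 * m ≤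
      (e + d + m + 1) * (e + d + m + 2) + (m + 1) * (m + 2) := by
    rw [← a1, ← a2, ← a3, ← a4]
    omega
  nlinarith [key]

/-! ### Separability, Hensel's lemma and derivatives -/

-- If all partial derivatives vanish, every exponent is divisible by `p`; since coefficients have
-- `p`-th roots, `g` is a `p`-th power.
open MvPolynomial in
theorem exists_pderiv_ne_zero_of_irreducible {σ F : Type*} [Field F] (p : ℕ) [Fact p.Prime]
    [CharP F p] [PerfectRing F p] {g : MvPolynomial σ F} (hg : Irreducible g) :
    ∃ i, pderiv i g ≠ 0 := by
  classical
  by_contra! h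
  have hp : p.Prime := Fact.out
  have hdvd : ∀ m ∈ g.support, ∀ i, p ∣ m i := by
    intro m hm i
    by_cases h0 : m i = 0
    · simp [h0]
    have hc := congrArg (coeff (m - Finsupp.single i 1)) (h i)
    have hle : Finsupp.single i 1 ≤ m := by
      rw [Finsupp.single_le_iff]; exact Nat.one_le_iff_ne_zero.2 h0
    have h1 : (m - Finsupp.single i 1 : σ →₀ ℕ) i + 1 = m i := by
      simp only [Finsupp.coe_tsub, Pi.sub_apply, Finsupp.single_eq_same]
      omega
    rw [coeff_pderiv, tsub_add_cancel_of_le hle, coeff_zero, mul_eq_zero,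
      or_iff_right (mem_support_iff.1 hm)] at hc
    rw [← CharP.cast_eq_zero_iff F p, ← hc, ← h1]
    push_cast
    rfl
  have hpow : g = (∑ m ∈ g.support, monomial (m.mapRange (· / p) (Nat.zero_div p))
      ((frobeniusEquiv F p).symm (coeff m g))) ^ p := by
    rw [sum_pow_char]
    conv_lhs => rw [g.as_sum]
    refine Finset.sum_congr rfl fun m hm => ?_
    have hpm : p • m.mapRange (· / p) (Nat.zero_div p) = m := by
      ext i
      simp [Nat.mul_div_cancel' (hdvd m hm i)]
    rw [monomial_pow, frobeniusEquiv_symm_pow_p, hpm]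
  rw [hpow] at hg
  exact not_irreducible_pow hp.ne_one hg

-- Newton iteration with the slope frozen at `0`: its inverse `u` stays an inverse of the derivative
-- mod `I` along the iterates, so each step gains a power of `I`.
open Polynomial in
theorem exists_isRoot_mem_of_isAdicComplete {R : Type*} [CommRing R] (I : Ideal R)
    [IsAdicComplete I R] (f : R[X]) (h₀ : f.eval 0 ∈ I) (h₁ : IsUnit (f.derivative.eval 0)) :
    ∃ z ∈ I, f.eval z = 0 := by
  obtain ⟨u, hu⟩ := h₁.exists_right_inv
  let c : ℕ → R := fun n => Nat.recOn n 0 fun _ b => b - f.eval b * u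
  have hc : ∀ n, c (n + 1) = c n - f.eval (c n) * u := fun n => rfl
  have hfc : ∀ n, c n ∈ I ∧ f.eval (c n) ∈ I ^ (n + 1) := by
    intro n
    induction n with
    | zero => exact ⟨I.zero_mem, by simpa [c] using h₀⟩
    | succ n ih =>
      obtain ⟨ih₁, ih₂⟩ := ih
      have hfI : f.eval (c n) ∈ I := Ideal.pow_le_self (Nat.succ_ne_zero n) ih₂
      refine ⟨by rw [hc]; exact I.sub_mem ih₁ (I.mul_mem_right _ hfI), ?_⟩
      obtain ⟨k, hk⟩ := f.binomExpansion (c n) (-(f.eval (c n) * u))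
      obtain ⟨l, hl⟩ := f.derivative.evalSubFactor (c n) 0
      have hd : 1 - f.derivative.eval (c n) * u + k * f.eval (c n) * u ^ 2 ∈ I := by
        have : 1 - f.derivative.eval (c n) * u = -(l * u) * c n := by
          linear_combination -hu - u * hl
        rw [this]
        exact I.add_mem (I.mul_mem_left _ ih₁) (I.mul_mem_right _ (I.mul_mem_left _ hfI))
      have hval : f.eval (c (n + 1)) = f.eval (c n) *
          (1 - f.derivative.eval (c n) * u + k * f.eval (c n) * u ^ 2) := by
        rw [hc, sub_eq_add_neg, hk]; ring
      rw [hval, pow_succ]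
      exact Ideal.mul_mem_mul ih₂ hd
  have hcauchy : ∀ m n, m ≤ n → c m ≡ c n [SMOD (I ^ m • ⊤ : Ideal R)] := by
    intro m n hmn
    rw [smul_eq_mul, Ideal.mul_top]
    induction n, hmn using Nat.le_induction with
    | base => rfl
    | succ n hn ih =>
      refine ih.trans ?_
      rw [SModEq.sub_mem, hc, sub_sub_cancel]
      exact Ideal.mul_mem_right _ _ (Ideal.pow_le_pow_right (by omega) (hfc n).2)
  obtain ⟨z, hz⟩ := IsPrecomplete.prec' c (hcauchy _ _)
  simp only [smul_eq_mul, Ideal.mul_top] at hz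
  refine ⟨z, ?_, ?_⟩
  · have := hz 1
    rw [pow_one, SModEq.sub_mem] at this
    simpa using I.sub_mem (hfc 1).1 this
  · refine IsHausdorff.haus' (I := I) _ fun n => ?_
    rw [smul_eq_mul, Ideal.mul_top]
    refine ((hz n).symm.eval f).trans ?_
    rw [SModEq.zero]
    exact Ideal.pow_le_pow_right (Nat.le_succ n) (hfc n).2

open Polynomial in
/-- Strong form of Hensel's lemma for power series over a field. -/
theorem exists_isRoot_of_X_pow_dvd_eval {F : Type*} [Field F] (f : (PowerSeries F)[X])
    (G : PowerSeries F) {M w : ℕ} (hM : 2 * w < M)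
    (hf : (PowerSeries.X : PowerSeries F) ^ M ∣ f.eval G)
    (hd : ∃ u : PowerSeries F, IsUnit u ∧ f.derivative.eval G = PowerSeries.X ^ w * u) :
    ∃ R, f.eval R = 0 ∧ (PowerSeries.X : PowerSeries F) ^ (M - w) ∣ G - R := by
  obtain ⟨u, hu, hd⟩ := hd
  obtain ⟨a, ha⟩ := hf
  -- One factor `x` is held back so that the rescaled constant term `x * a`, and hence the root `z`,
  -- lies in `(x)`; this yields the final factor in `x ^ (M - w)`.
  obtain ⟨k, rfl⟩ : ∃ k, M = 2 * w + (k + 1) := ⟨M - 2 * w - 1, by omega⟩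
  set x : PowerSeries F := PowerSeries.X
  -- substitute `x ^ (w + k) z` and divide by `x ^ (2 w + k)`
  obtain ⟨r, hr⟩ : ∃ r : (PowerSeries F)[X], taylor G f =
      C (f.eval G) + C (f.derivative.eval G) * X + X ^ 2 * r := by
    obtain ⟨r₁, hr₁⟩ := X_dvd_iff.2 (show (taylor G f - C (f.eval G)).coeff 0 = 0 by
      rw [coeff_sub, taylor_coeff_zero, coeff_C_zero, sub_self])
    obtain ⟨r₂, hr₂⟩ := X_dvd_iff.2 (show (r₁ - C (f.derivative.eval G)).coeff 0 = 0 by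
      have := congrArg (coeff · 1) hr₁
      simp only [coeff_X_mul, coeff_sub, taylor_coeff_one, coeff_C_succ, sub_zero] at this
      rw [coeff_sub, coeff_C_zero, ← this, sub_self])
    exact ⟨r₂, by linear_combination hr₁ + X * hr₂⟩
  let q : (PowerSeries F)[X] := C (x * a) + C u * X + C (x ^ k) * X ^ 2 * r.comp (C (x ^ (w + k)) * X)
  obtain ⟨z, hz, hqz⟩ := exists_isRoot_mem_of_isAdicComplete (Ideal.span {x}) q
    (by simp [q, Ideal.mem_span_singleton]) (by simpa [q] using hu)
  have hev : ∀ y, f.eval (G + x ^ (w + k) * y) = x ^ (2 * w + k) * q.eval y := by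
    intro y
    rw [add_comm, ← taylor_eval, hr]
    simp only [q, eval_add, eval_mul, eval_C, eval_X, eval_pow, eval_comp, ha, hd]
    ring
  refine ⟨G + x ^ (w + k) * z, by rw [hev, hqz, mul_zero], ?_⟩
  obtain ⟨y, rfl⟩ := Ideal.mem_span_singleton.1 hz
  refine ⟨-y, ?_⟩
  rw [show 2 * w + (k + 1) - w = w + k + 1 by omega]
  ring

open MvPolynomial in
theorem totalDegree_pderiv_add_one_le {σ R : Type*} [CommSemiring R] {i : σ}
    {g : MvPolynomial σ R} (h : pderiv i g ≠ 0) :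
    (pderiv i g).totalDegree + 1 ≤ g.totalDegree := by
  classical
  have hmem : ∀ m ∈ (pderiv i g).support, (m.sum fun _ e => e) + 1 ≤ g.totalDegree := by
    intro m hm
    have hm' : m + Finsupp.single i 1 ∈ g.support := by
      rw [mem_support_iff, coeff_pderiv] at *
      exact left_ne_zero_of_mul hm
    have := le_totalDegree hm'
    rwa [Finsupp.sum_add_index' (by simp) (by simp), Finsupp.sum_single_index rfl] at this
  obtain ⟨m, hm⟩ := support_nonempty.2 h
  have := hmem m hm
  suffices (pderiv i g).totalDegree ≤ g.totalDegree - 1 by omega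
  exact Finset.sup_le fun m hm => by have := hmem m hm; omega

open MvPolynomial in
theorem derivative_aeval_X_pair {F : Type*} [Field F] (G : PowerSeries F)
    (g : MvPolynomial (Fin 2) F) :
    PowerSeries.derivative F (aeval ![PowerSeries.X, G] g) =
      aeval ![PowerSeries.X, G] (pderiv 0 g) +
        aeval ![PowerSeries.X, G] (pderiv 1 g) * PowerSeries.derivative F G := by
  induction g using MvPolynomial.induction_on with
  | C a => simp
  | add p q hp hq => simp only [map_add, hp, hq]; ring
  | mul_X p i hp =>
    simp only [map_mul, Derivation.leibniz, hp, map_add, smul_eq_mul, aeval_X]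
    fin_cases i <;> simp [pderiv_X] <;> ring

theorem X_pow_dvd_derivative {R : Type*} [CommSemiring R] {f : PowerSeries R} {m : ℕ}
    (h : PowerSeries.X ^ (m + 1) ∣ f) : PowerSeries.X ^ m ∣ PowerSeries.derivative R f := by
  rw [PowerSeries.X_pow_dvd_iff] at *
  intro k hk
  rw [PowerSeries.coeff_derivative, h _ (by omega), zero_mul]

/-! ### From approximate roots to power series roots -/

/-- The polynomial `g(x, y)` regarded as a polynomial in `y` over `F⟦x⟧`. -/
noncomputable def polyOverPowerSeries {F : Type*} [Field F] (g : MvPolynomial (Fin 2) F) :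
    Polynomial (PowerSeries F) :=
  MvPolynomial.aeval ![Polynomial.C PowerSeries.X, Polynomial.X] g

section

variable {F : Type*} [Field F] (g : MvPolynomial (Fin 2) F)

open MvPolynomial

theorem eval_polyOverPowerSeries (G : PowerSeries F) :
    (polyOverPowerSeries g).eval G = aeval ![PowerSeries.X, G] g := by
  unfold polyOverPowerSeries
  induction g using MvPolynomial.induction_on with
  | C a => simp [Polynomial.algebraMap_apply, algHom_C]
  | add p q hp hq => simp only [map_add, Polynomial.eval_add, hp, hq]
  | mul_X p i hp => fin_cases i <;> simp [hp]

theorem derivative_polyOverPowerSeries :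
    (polyOverPowerSeries g).derivative = polyOverPowerSeries (pderiv 1 g) := by
  unfold polyOverPowerSeries
  induction g using MvPolynomial.induction_on with
  | C a => simp [Polynomial.algebraMap_apply, algHom_C]
  | add p q hp hq => simp only [map_add, hp, hq]
  | mul_X p i hp =>
    simp only [map_mul, Polynomial.derivative_mul, hp, Derivation.leibniz, map_add, smul_eq_mul,
      aeval_X]
    fin_cases i <;> simp [pderiv_X] <;> ring

theorem natDegree_polyOverPowerSeries_le :
    (polyOverPowerSeries g).natDegree ≤ g.totalDegree := by
  unfold polyOverPowerSeries
  rw [aeval_def, eval₂_eq']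
  refine Polynomial.natDegree_sum_le_of_forall_le _ _ fun m hm => ?_
  rw [Polynomial.algebraMap_apply]
  refine (Polynomial.natDegree_C_mul_le _ _).trans ?_
  simp only [Fin.prod_univ_two, Matrix.cons_val_zero, Matrix.cons_val_one]
  rw [← Polynomial.C_pow]
  refine (Polynomial.natDegree_C_mul_le _ _).trans ?_
  rw [Polynomial.natDegree_X_pow]
  have := le_totalDegree hm
  rw [Finsupp.sum_fintype _ _ (by simp), Fin.sum_univ_two] at this
  omega

theorem exists_root_congr_of_irreducible [Finite F] {g : MvPolynomial (Fin 2) F}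
    (hg : Irreducible g) {G : PowerSeries F} {M : ℕ}
    (hM : 2 * (g.totalDegree * (g.totalDegree - 1)) + 2 ≤ M)
    (hG : (PowerSeries.X : PowerSeries F) ^ M ∣ aeval ![PowerSeries.X, G] g) :
    ∃ R ∈ (polyOverPowerSeries g).roots,
      (PowerSeries.X : PowerSeries F) ^ (M - g.totalDegree * (g.totalDegree - 1)) ∣ G - R := by
  obtain ⟨p, hp⟩ := CharP.exists F
  have : Fact p.Prime := ⟨CharP.char_is_prime F p⟩
  set e := g.totalDegree
  -- A nonzero partial derivative has smaller degree than the irreducible `g`, so the two are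
  -- coprime and Bézout applies.
  have hbound : ∀ i m, pderiv i g ≠ 0 → m ≤ M →
      (PowerSeries.X : PowerSeries F) ^ m ∣ aeval ![PowerSeries.X, G] (pderiv i g) →
      m ≤ e * (e - 1) := by
    intro i m hi hmM hm
    have hlt := totalDegree_pderiv_add_one_le hi
    refine (le_totalDegree_mul_of_X_pow_dvd_aeval hi hg.ne_zero (fun a ha => ?_) G hm
      ((pow_dvd_pow _ hmM).trans hG)).trans ?_
    · refine (hg.prime.dvd_or_dvd ha).resolve_left fun hd => ?_
      have := totalDegree_le_of_dvd_of_isDomain hd hi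
      omega
    · rw [mul_comm]
      exact Nat.mul_le_mul_left _ (by omega)
  have hy : pderiv 1 g ≠ 0 := by
    -- Otherwise the chain rule makes `∂g/∂x` at `(x, G)` the derivative of `g(x, G)`, which
    -- vanishes to order `M - 1 > e(e-1)`.
    intro hy
    obtain ⟨i, hi⟩ := exists_pderiv_ne_zero_of_irreducible p hg
    have hx : pderiv 0 g ≠ 0 := by
      fin_cases i
      · exact hi
      · exact absurd hy hi
    have hM1 : M - 1 + 1 = M := by omega
    have hd := X_pow_dvd_derivative (m := M - 1) (hM1.symm ▸ hG)
    rw [derivative_aeval_X_pair, hy, map_zero, zero_mul, add_zero] at hd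
    have := hbound 0 _ hx (by omega) hd
    omega
  set D := aeval ![PowerSeries.X, G] (pderiv 1 g) with hD
  have hnd : ¬ (PowerSeries.X : PowerSeries F) ^ (e * (e - 1) + 1) ∣ D := fun h => by
    have := hbound 1 _ hy (by omega) h
    omega
  have hD0 : D ≠ 0 := fun h => hnd (h ▸ dvd_zero _)
  obtain ⟨w, u, hXu, hDu⟩ := WfDvdMonoid.max_power_factor hD0 PowerSeries.X_irreducible
  have hu : IsUnit u := by
    rw [PowerSeries.isUnit_iff_constantCoeff, isUnit_iff_ne_zero]
    exact fun h => hXu (PowerSeries.X_dvd_iff.2 h)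
  have hw : w ≤ e * (e - 1) := by
    by_contra! h
    exact hnd ((pow_dvd_pow _ h).trans ⟨u, hDu⟩)
  have hder : (polyOverPowerSeries g).derivative.eval G = D := by
    rw [derivative_polyOverPowerSeries, eval_polyOverPowerSeries]
  obtain ⟨R, hR, hGR⟩ := exists_isRoot_of_X_pow_dvd_eval (polyOverPowerSeries g) G
    (M := M) (w := w) (by omega) (by rwa [eval_polyOverPowerSeries]) ⟨u, hu, hder.trans hDu⟩
  refine ⟨R, ?_, (pow_dvd_pow _ (by omega)).trans hGR⟩
  rw [Polynomial.mem_roots', Polynomial.IsRoot]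
  refine ⟨fun h => hD0 ?_, hR⟩
  rw [← hder, h]
  simp

end

/-! ### Reduction to irreducible polynomials -/

-- If every irreducible factor had order below `2 * s` times its degree, additivity would give `h`
-- order at most `2 * h.totalDegree * s < 2 * s ^ 2`.
open MvPolynomial in
theorem exists_irreducible_of_X_pow_dvd_aeval {F : Type*} [Field F] {h : MvPolynomial (Fin 2) F}
    (hh : h ≠ 0) (G : PowerSeries F) {s N : ℕ} (hs : h.totalDegree < s) (hN : 2 * s ^ 2 ≤ N)
    (hG : (PowerSeries.X : PowerSeries F) ^ N ∣ aeval ![PowerSeries.X, G] h) :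
    ∃ g : MvPolynomial (Fin 2) F, Irreducible g ∧ g.totalDegree < s ∧
      (PowerSeries.X : PowerSeries F) ^ (2 * g.totalDegree * s) ∣ aeval ![PowerSeries.X, G] g := by
  by_contra! hcon
  have key : ∀ f : MvPolynomial (Fin 2) F, f ≠ 0 → f ∣ h →
      (aeval ![PowerSeries.X, G] f).order ≤ ((2 * f.totalDegree * s : ℕ) : ℕ∞) := by
    intro f
    induction f using WfDvdMonoid.induction_on_irreducible with
    | zero => exact fun h0 => absurd rfl h0
    | unit u hu =>
      intro _ _
      rw [PowerSeries.order_zero_of_unit (hu.map _)]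
      exact zero_le
    | mul a i ha hi ih =>
      intro hia hdvd
      rw [map_mul, PowerSeries.order_mul, totalDegree_mul_of_isDomain hi.ne_zero ha, mul_add,
        add_mul, Nat.cast_add]
      refine add_le_add ?_ (ih ha ((dvd_mul_left _ _).trans hdvd))
      have hidvd : i ∣ h := (dvd_mul_right _ _).trans hdvd
      have := hcon i hi ((totalDegree_le_of_dvd_of_isDomain hidvd hh).trans_lt hs)
      rw [PowerSeries.X_pow_dvd_iff] at this
      push Not at this
      obtain ⟨m, hm, hc⟩ := this
      exact (PowerSeries.order_le m hc).trans (Nat.cast_le.2 hm.le)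
  have h1 : (N : ℕ∞) ≤ (aeval ![PowerSeries.X, G] h).order := 
    PowerSeries.nat_le_order _ _ (PowerSeries.X_pow_dvd_iff.1 hG)
  have h2 : N ≤ 2 * h.totalDegree * s := by exact_mod_cast h1.trans (key h hh dvd_rfl)
  nlinarith

/-! ### Measure estimates and Borel–Cantelli -/

section

variable {F : Type*} [Field F] [Fintype F] [MeasurableSpace F] [MeasurableSingletonClass F]

open MvPolynomial

theorem uniformSeqMeasure_cylinder (v : ℕ → F) (K : ℕ) :
    uniformSeqMeasure F {S | ∀ n < K, S n = v n} = ((Fintype.card F : ENNReal)⁻¹) ^ K := by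
  have : {S : ℕ → F | ∀ n < K, S n = v n} = Set.pi (Finset.range K) fun n => {v n} := by
    ext S
    simp
  rw [this, uniformSeqMeasure, Measure.infinitePi_pi _ fun _ _ => measurableSet_singleton _]
  rw [Finset.prod_congr rfl fun n _ => PMF.toMeasure_apply_singleton _ _ (measurableSet_singleton _)]
  simp

theorem uniformSeqMeasure_X_pow_dvd_le {g : MvPolynomial (Fin 2) F} (hg : Irreducible g) {M : ℕ}
    (hM : 2 * (g.totalDegree * (g.totalDegree - 1)) + 2 ≤ M) :
    uniformSeqMeasure F {S | VanishesModXPow S M g} ≤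
      g.totalDegree *
        ((Fintype.card F : ENNReal)⁻¹) ^ (M - g.totalDegree * (g.totalDegree - 1)) := by
  classical
  set K := M - g.totalDegree * (g.totalDegree - 1)
  have hsub : {S | VanishesModXPow S M g} ⊆ ⋃ R ∈ (polyOverPowerSeries g).roots.toFinset,
      {S : ℕ → F | ∀ n < K, S n = PowerSeries.coeff n R} := by
    intro S hS
    obtain ⟨R, hR, hdvd⟩ := exists_root_congr_of_irreducible hg hM hS
    refine Set.mem_iUnion₂.2 ⟨R, Multiset.mem_toFinset.2 hR, fun n hn => ?_⟩
    have := PowerSeries.X_pow_dvd_iff.1 hdvd n hn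
    rwa [map_sub, genFun, PowerSeries.coeff_mk, sub_eq_zero] at this
  refine (measure_mono hsub).trans ((measure_biUnion_finset_le _ _).trans ?_)
  rw [Finset.sum_congr rfl fun R _ => uniformSeqMeasure_cylinder (fun n => PowerSeries.coeff n R) K,
    Finset.sum_const, nsmul_eq_mul]
  gcongr
  exact ((Multiset.toFinset_card_le _).trans (Polynomial.card_roots' _)).trans
    (natDegree_polyOverPowerSeries_le g)

/-- The sequences whose generating function is an approximate root, of order `2 e s`, of some
irreducible polynomial of total degree `e < s`. -/
def irreducibleExceptionalSet (F : Type*) [Field F] (s : ℕ) : Set (ℕ → F) :=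
  {S | ∃ g : MvPolynomial (Fin 2) F, Irreducible g ∧ g.totalDegree < s ∧
    VanishesModXPow S (2 * g.totalDegree * s) g}

theorem uniformSeqMeasure_exceptional_degree_le {e s : ℕ} (hes : e < s) :
    uniformSeqMeasure F {S | ∃ g : MvPolynomial (Fin 2) F, Irreducible g ∧ g.totalDegree = e ∧
      VanishesModXPow S (2 * e * s) g} ≤ s * ENNReal.ofReal ((√2)⁻¹ ^ s) := by
  rcases Nat.eq_zero_or_pos e with rfl | he
  -- Constants are zero or units, so none is irreducible.
  · refine (le_of_eq ?_).trans zero_le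
    convert measure_empty (μ := uniformSeqMeasure F)
    rw [Set.eq_empty_iff_forall_notMem]
    rintro S ⟨g, hg, h0, -⟩
    refine hg.not_isUnit ?_
    rw [isUnit_iff_totalDegree_of_isReduced]
    refine ⟨?_, h0⟩
    rw [isUnit_iff_ne_zero]
    intro hc
    rw [totalDegree_eq_zero_iff_eq_C.1 h0, hc, C_0] at hg
    exact hg.ne_zero rfl
  set V := restrictTotalDegree (Fin 2) F e
  have : Finite V := Module.finite_of_finite F
  have : Fintype V := Fintype.ofFinite V
  set K := 2 * e * s - e * (e - 1) with hK
  set T := Module.finrank F V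
  have hT : 2 * T = (e + 1) * (e + 2) := finrank_restrictTotalDegree_fin_two F e
  -- The union bound costs `q ^ T`; the surplus `j ≥ s/2` of matched coefficients supplies the
  -- decay, using `1 ≤ e < s`.
  obtain ⟨j, hj, hsj⟩ : ∃ j, K = T + j ∧ s ≤ 2 * j := by
    obtain ⟨t, rfl⟩ := Nat.exists_eq_add_of_lt hes
    obtain ⟨d, rfl⟩ := Nat.exists_eq_add_of_le' he
    have hK' : K + (d + 1) * d = 2 * (d + 1) * (d + 1 + t + 1) := by
      rw [hK, Nat.add_sub_cancel]
      exact Nat.sub_add_cancel (by nlinarith)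
    refine ⟨K - T, ?_, ?_⟩
    · have : T ≤ K := by nlinarith
      omega
    · have : 2 * T + (d + 1 + t + 1) ≤ 2 * K := by nlinarith
      omega
  have hM : 2 * (e * (e - 1)) + 2 ≤ 2 * e * s := by
    obtain ⟨d, rfl⟩ := Nat.exists_eq_add_of_le' he
    rw [Nat.add_sub_cancel]
    nlinarith
  have hsub : {S | ∃ g : MvPolynomial (Fin 2) F, Irreducible g ∧ g.totalDegree = e ∧
      VanishesModXPow S (2 * e * s) g} ⊆ ⋃ g : V, {S | Irreducible g.1 ∧ g.1.totalDegree = e ∧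
        VanishesModXPow S (2 * e * s) g.1} := by
    rintro S ⟨g, hg, hge, hS⟩
    exact Set.mem_iUnion.2 ⟨⟨g, (mem_restrictTotalDegree _ _ _).2 hge.le⟩, hg, hge, hS⟩
  have hone : ∀ g : V, uniformSeqMeasure F {S | Irreducible g.1 ∧ g.1.totalDegree = e ∧
        VanishesModXPow S (2 * e * s) g.1} ≤ e * ((Fintype.card F : ENNReal)⁻¹) ^ K := by
    intro g
    by_cases hg : Irreducible g.1 ∧ g.1.totalDegree = e
    · obtain ⟨hg, hge⟩ := hg
      have := uniformSeqMeasure_X_pow_dvd_le hg (M := 2 * e * s) (by rwa [hge])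
      rw [hge] at this
      exact (measure_mono fun S hS => hS.2.2).trans this
    · refine (le_of_eq ?_).trans zero_le
      convert measure_empty (μ := uniformSeqMeasure F)
      rw [Set.eq_empty_iff_forall_notMem]
      exact fun S hS => hg ⟨hS.1, hS.2.1⟩
  have hq0 : (Fintype.card F : ENNReal) ≠ 0 := by simp
  have hqt : (Fintype.card F : ENNReal) ≠ ⊤ := ENNReal.natCast_ne_top _
  have hcardV : (Fintype.card V : ENNReal) = (Fintype.card F : ENNReal) ^ T := by
    rw [Module.card_eq_pow_finrank (K := F) (V := V)]
    push_cast
    rfl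
  have hpow : ((Fintype.card F : ENNReal)⁻¹) ^ j ≤ ENNReal.ofReal ((√2)⁻¹ ^ s) := by
    calc ((Fintype.card F : ENNReal)⁻¹) ^ j ≤ (2⁻¹ : ENNReal) ^ j := by
          gcongr
          exact_mod_cast (Fintype.one_lt_card : 1 < Fintype.card F)
      _ = ENNReal.ofReal ((√2)⁻¹ ^ (2 * j)) := by
          rw [pow_mul, inv_pow, Real.sq_sqrt zero_le_two, ENNReal.ofReal_pow (by norm_num),
            ENNReal.ofReal_inv_of_pos two_pos]
          norm_num
      _ ≤ _ := by
          apply ENNReal.ofReal_le_ofReal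
          exact pow_le_pow_of_le_one (by positivity)
            (inv_le_one_of_one_le₀ (Real.one_le_sqrt.2 one_le_two)) hsj
  calc _ ≤ ∑ g : V, (e : ENNReal) * ((Fintype.card F : ENNReal)⁻¹) ^ K :=
        (measure_mono hsub).trans ((measure_iUnion_fintype_le _ _).trans
          (Finset.sum_le_sum fun g _ => hone g))
    _ = e * (((Fintype.card F : ENNReal) * (Fintype.card F : ENNReal)⁻¹) ^ T *
          ((Fintype.card F : ENNReal)⁻¹) ^ j) := by
        rw [Finset.sum_const, nsmul_eq_mul, Finset.card_univ, hcardV, hj, pow_add, mul_pow]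
        ring
    _ ≤ _ := by
        rw [ENNReal.mul_inv_cancel hq0 hqt, one_pow, one_mul]
        gcongr

theorem uniformSeqMeasure_exceptional_le (s : ℕ) :
    uniformSeqMeasure F (irreducibleExceptionalSet F s) ≤
      ENNReal.ofReal ((s : ℝ) ^ 2 * (√2)⁻¹ ^ s) := by
  have hsub : irreducibleExceptionalSet F s ⊆ ⋃ e ∈ Finset.range s,
      {S | ∃ g : MvPolynomial (Fin 2) F, Irreducible g ∧ g.totalDegree = e ∧
        VanishesModXPow S (2 * e * s) g} := by
    rintro S ⟨g, hg, hgs, hS⟩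
    exact Set.mem_iUnion₂.2 ⟨_, Finset.mem_range.2 hgs, g, hg, rfl, hS⟩
  refine (measure_mono hsub).trans ((measure_biUnion_finset_le _ _).trans
    ((Finset.sum_le_sum fun e he =>
      uniformSeqMeasure_exceptional_degree_le (Finset.mem_range.1 he)).trans_eq ?_))
  rw [Finset.sum_const, nsmul_eq_mul, Finset.card_range, ENNReal.ofReal_mul (by positivity),
    ENNReal.ofReal_pow (Nat.cast_nonneg s), ENNReal.ofReal_natCast]
  ring

theorem ae_eventually_notMem_irreducibleExceptionalSet :
    ∀ᵐ S ∂(uniformSeqMeasure F), ∀ᶠ s in atTop, S ∉ irreducibleExceptionalSet F s := by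
  refine ae_eventually_notMem (ne_top_of_le_ne_top ?_
    (ENNReal.tsum_le_tsum uniformSeqMeasure_exceptional_le))
  refine Summable.tsum_ofReal_ne_top ?_
  refine summable_pow_mul_geometric_of_norm_lt_one 2 ?_
  rw [Real.norm_of_nonneg (by positivity)]
  exact inv_lt_one_of_one_lt₀ (Real.lt_sqrt_of_sq_lt (by norm_num))

end

/-! ### The lower bound on expansion complexity -/

open MvPolynomial in
theorem le_expansionComplexity_of_notMem {F : Type*} [Field F] {S : ℕ → F} {s N : ℕ}
    (hs : 2 ≤ s) (hN : 2 * s ^ 2 ≤ N) (hS : S ∉ irreducibleExceptionalSet F s) :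
    s ≤ expansionComplexity S N := by
  have key : ∀ h : MvPolynomial (Fin 2) F, h ≠ 0 → VanishesModXPow S N h → s ≤ h.totalDegree := by
    intro h hh hv
    by_contra! hlt
    exact hS (exists_irreducible_of_X_pow_dvd_aeval hh (genFun S) hlt hN hv)
  unfold expansionComplexity
  split_ifs with h0
  -- If the first `N` terms vanish, `h = y` has degree `1 < s`, so the value `0` never occurs here.
  · have := key (X 1) (X_ne_zero 1) (by
      rw [VanishesModXPow, aeval_X, PowerSeries.X_pow_dvd_iff]
      simpa [genFun] using h0)
    rw [totalDegree_X] at this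
    omega
  -- Nonemptiness matters: `sInf ∅` would be `0`.
  · refine le_csInf ⟨_, X 0 ^ N, pow_ne_zero _ (X_ne_zero 0), ?_, rfl⟩ ?_
    · simp [VanishesModXPow]
    · rintro d ⟨h, hh, hv, rfl⟩
      exact key h hh hv

theorem theorem3p1 {F : Type*} [Field F] [Fintype F] [MeasurableSpace F]
    [MeasurableSingletonClass F] :
    ∀ᵐ S ∂(uniformSeqMeasure F),
      ((Real.sqrt 2 / 2 : ℝ) : EReal) ≤
        liminf (fun N : ℕ =>
          (((expansionComplexity S N : ℝ) / Real.sqrt (N : ℝ) : ℝ) : EReal)) atTop := by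
  filter_upwards [ae_eventually_notMem_irreducibleExceptionalSet (F := F)] with S hS
  have hsqrt : Tendsto (fun N : ℕ => Nat.sqrt (N / 2)) atTop atTop :=
    tendsto_atTop_atTop.2 fun b => ⟨b * b * 2, fun N hN =>
      Nat.le_sqrt.2 ((Nat.le_div_iff_mul_le two_pos).2 hN)⟩
  -- From `√N ≤ √2 * (s + 1)` one gets `s / √N ≥ √2 / 2 - 1 / √N`; rounding costs only the vanishing
  -- term.
  have hlim : Tendsto (fun N : ℕ => ((√2 / 2 - 1 / √(N : ℝ) : ℝ) : EReal)) atTop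
      (nhds ((√2 / 2 : ℝ) : EReal)) := by
    refine (continuous_coe_real_ereal.tendsto _).comp ?_
    have : Tendsto (fun N : ℕ => 1 / √(N : ℝ)) atTop (nhds 0) :=
      tendsto_const_nhds.div_atTop (Real.tendsto_sqrt_atTop.comp tendsto_natCast_atTop_atTop)
    simpa using tendsto_const_nhds.sub this
  rw [← hlim.liminf_eq]
  refine liminf_le_liminf ?_
  filter_upwards [hsqrt.eventually hS, hsqrt.eventually_ge_atTop 2, eventually_gt_atTop 0]
    with N hN h2 hpos
  set s := Nat.sqrt (N / 2)
  have hsN : 2 * s ^ 2 ≤ N := by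
    have := Nat.sqrt_le' (N / 2)
    change s ^ 2 ≤ N / 2 at this
    omega
  have hNs : N ≤ 2 * (s + 1) ^ 2 := by
    have := Nat.lt_succ_sqrt' (N / 2)
    change N / 2 < (s + 1) ^ 2 at this
    omega
  have hE : (s : ℝ) ≤ expansionComplexity S N :=
    Nat.cast_le.2 (le_expansionComplexity_of_notMem h2 hsN hN)
  have hN0 : 0 < √(N : ℝ) := Real.sqrt_pos.2 (Nat.cast_pos.2 hpos)
  have hroot : √(N : ℝ) ≤ √2 * (s + 1) := by
    rw [Real.sqrt_le_left (by positivity), mul_pow, Real.sq_sqrt zero_le_two]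
    exact_mod_cast hNs
  rw [EReal.coe_le_coe_iff, le_div_iff₀ hN0, sub_mul, one_div, inv_mul_cancel₀ hN0.ne']
  have h22 : √2 * √2 = 2 := Real.mul_self_sqrt zero_le_two
  nlinarith [mul_le_mul_of_nonneg_left hroot (Real.sqrt_nonneg 2)]
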